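/- Let $(a_k)_{k\ge 0}$ be the sequence defined by $a_0=a_1=1$ and $a_k=4a_{k-1}-a_{k-2}$ for $k\ge 2$. For an integer $n\ge 3$, let $CL_n$ be the circular ladder graph of order $2n$, that is, the simple graph with vertices $u_1^+,\dots,u_n^+,u_1^-,\dots,u_n^-$ and edges $u_i^{\varepsilon}u_{i+1}^{\varepsilon}$ (for $1\le i\le n$ and $\varepsilon=\pm$, indices modulo $n$) and $u_i^+u_i^-$ (for $1\le i\le n$). Then the number $s(CL_n)$ of spanning trees of $CL_n$ is $$s(CL_n)=\frac{1}{2}\,n\,(a_{n+1}+a_n-2).$$ -/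

import Mathlib

/-- The sequence `a` with `a 0 = a 1 = 1` and `a (n + 2) = 4 * a (n + 1) - a n`. -/
def aSeq : ℕ → ℤ
  | 0 => 1
  | 1 => 1
  | n + 2 => 4 * aSeq (n + 1) - aSeq n

/-- The circular ladder on `2 * n` vertices: two copies (indexed by `Bool`) of the cycle on
`Fin n`, with a spoke joining the two copies of each vertex. -/
def circularLadder (n : ℕ) : SimpleGraph (Fin n × Bool) :=
  SimpleGraph.boxProd (SimpleGraph.cycleGraph n) (⊤ : SimpleGraph Bool)

/-- The set of spanning trees of `G`: subgraphs on the whole vertex set that are trees. -/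
def spanningTrees {V : Type*} (G : SimpleGraph V) : Set (SimpleGraph V) :=
  {T | T ≤ G ∧ T.IsTree}

/-- The number of spanning trees of a (finite) graph. -/
noncomputable def numSpanningTrees {V : Type*} (G : SimpleGraph V) : ℕ :=
  (spanningTrees G).ncard

/-! By Kirchhoff the tree count τ is det(L + e_r e_rᵀ), L being the Laplacian. As L has zero row and
column sums, replacing e_r e_rᵀ by u wᵀ multiplies this by (∑u)(∑w)
(`Matrix.det_add_vecMulVec_of_sums_eq_zero`). With u = w the indicator of one spoke, the result is
4τ, and the symmetry swapping the two cycles is kept. It splits the determinant into det(C + 2e₀e₀ᵀ)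
· det(C + 2), where C is the Laplacian of the n-cycle. The first factor is 2n; the second is tⁿ +
t⁻ⁿ - 2 with t = 2 + √3, which is a_{n+1} + a_n - 2. -/

open Matrix

/-! ### Spanning trees as parent maps towards a root -/

section ParentMaps

variable {V : Type*}

/-- `f` sends every vertex other than `r` to one of its neighbours in `G`, fixes `r`, and its
iterates lead every vertex to `r`. -/
def IsParentMap (G : SimpleGraph V) (r : V) (f : V → V) : Prop :=
  f r = r ∧ (∀ v, v ≠ r → G.Adj v (f v)) ∧ ∀ v, ∃ k, f^[k] v = r

/-- The graph whose edges join every vertex to its image under `f`. -/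
def parentGraph (f : V → V) : SimpleGraph V :=
  SimpleGraph.fromRel fun v w => f v = w

theorem parentGraph_adj {f : V → V} {v w : V} :
    (parentGraph f).Adj v w ↔ v ≠ w ∧ (f v = w ∨ f w = v) :=
  SimpleGraph.fromRel_adj _ _ _

namespace IsParentMap

variable {G : SimpleGraph V} {r : V} {f g : V → V}

theorem adj_parentGraph (hf : IsParentMap G r f) {v : V} (hv : v ≠ r) :
    (parentGraph f).Adj v (f v) :=
  parentGraph_adj.2 ⟨(hf.2.1 v hv).ne, Or.inl rfl⟩

theorem parentGraph_le (hf : IsParentMap G r f) : parentGraph f ≤ G := by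
  intro v w h
  obtain ⟨hne, rfl | rfl⟩ := parentGraph_adj.1 h
  · refine hf.2.1 v fun hv => hne ?_
    rw [hv, hf.1]
  · refine (hf.2.1 w fun hw => hne ?_).symm
    rw [hw, hf.1]

theorem connected_parentGraph (hf : IsParentMap G r f) : (parentGraph f).Connected := by
  have key : ∀ k v, f^[k] v = r → (parentGraph f).Reachable v r := by
    intro k
    induction k with
    | zero => rintro v rfl; exact .rfl
    | succ k ih =>
      intro v hv
      by_cases hvr : v = r
      · rw [hvr]
      · exact (hf.adj_parentGraph hvr).reachable.trans (ih _ hv)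
  have key' : ∀ v, (parentGraph f).Reachable v r := fun v =>
    let ⟨k, hk⟩ := hf.2.2 v
    key k v hk
  exact { preconnected := fun v w => (key' v).trans (key' w).symm, nonempty := ⟨r⟩ }

theorem isTree_parentGraph [Finite V] (hf : IsParentMap G r f) : (parentGraph f).IsTree := by
  rw [SimpleGraph.isTree_iff_connected_and_card]
  refine ⟨hf.connected_parentGraph, le_antisymm ?_
    hf.connected_parentGraph.card_vert_le_card_edgeSet_add_one⟩
  have hsub : (parentGraph f).edgeSet ⊆ (fun v => s(v, f v)) '' {r}ᶜ := by
    intro e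
    induction e with | _ v w
    intro h
    obtain ⟨hne, rfl | rfl⟩ := parentGraph_adj.1 ((SimpleGraph.mem_edgeSet _).1 h)
    · refine ⟨v, fun hv => hne ?_, rfl⟩
      rw [Set.mem_singleton_iff.1 hv, hf.1]
    · refine ⟨w, fun hw => hne ?_, Sym2.eq_swap⟩
      rw [Set.mem_singleton_iff.1 hw, hf.1]
  have h1 := (Set.ncard_le_ncard hsub (Set.toFinite _)).trans
    (Set.ncard_image_le (Set.toFinite _))
  have h2 := Set.ncard_add_ncard_compl ({r} : Set V)
  rw [Set.ncard_singleton] at h2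
  rw [Nat.card_coe_set_eq]
  omega

theorem eq_root_of_apply_apply_eq (hf : IsParentMap G r f) {v : V} (h : f (f v) = v) : v = r := by
  obtain ⟨k, hk⟩ := hf.2.2 v
  have hper : ∀ j, f^[2 * j] v = v := by
    intro j
    induction j with
    | zero => rfl
    | succ j ih =>
      rw [show 2 * (j + 1) = 2 * j + 1 + 1 by ring, Function.iterate_succ_apply,
        Function.iterate_succ_apply, h, ih]
  have hroot : ∀ j, f^[j] r = r := Function.iterate_fixed hf.1
  rw [← hper k, two_mul, Function.iterate_add_apply, hk, hroot]

/-- Induct on the number of steps to the root. If `g` oriented the edge from `v` to `f v` the other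
way, then `g (f v) = v`; by induction `f (f v) = v`, a 2-cycle that never reaches `r`. -/
theorem eq_of_parentGraph_eq (hf : IsParentMap G r f) (hg : IsParentMap G r g)
    (h : parentGraph f = parentGraph g) : f = g := by
  have key : ∀ k v, f^[k] v = r → f v = g v := by
    intro k
    induction k with
    | zero => rintro v rfl; exact hf.1.trans hg.1.symm
    | succ k ih =>
      intro v hv
      by_cases hvr : v = r
      · rw [hvr, hf.1, hg.1]
      · have hadj := hf.adj_parentGraph hvr
        rw [h] at hadj
        obtain ⟨-, h' | h'⟩ := parentGraph_adj.1 hadj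
        · exact h'.symm
        · rw [← ih _ hv] at h'
          exact absurd (hf.eq_root_of_apply_apply_eq h') hvr
  funext v
  obtain ⟨k, hk⟩ := hf.2.2 v
  exact key k v hk

end IsParentMap

theorem SimpleGraph.Connected.exists_adj_dist_lt {G : SimpleGraph V} (hG : G.Connected) {v r : V}
    (h : v ≠ r) : ∃ w, G.Adj v w ∧ G.dist w r < G.dist v r := by
  obtain ⟨p, hp⟩ := hG.exists_walk_length_eq_dist v r
  cases p with
  | nil => exact absurd rfl h
  | @cons _ w _ hadj p =>
    refine ⟨w, hadj, ?_⟩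
    rw [← hp, SimpleGraph.Walk.length_cons]
    exact Nat.lt_succ_of_le (SimpleGraph.dist_le p)

theorem SimpleGraph.Connected.exists_isParentMap {T : SimpleGraph V} (hT : T.Connected) (r : V) :
    ∃ f, IsParentMap T r f := by
  classical
  choose! p hp using fun v (hv : v ≠ r) => hT.exists_adj_dist_lt hv
  have hr : (fun v => if v = r then r else p v) r = r := if_pos rfl
  refine ⟨fun v => if v = r then r else p v, hr, fun v hv => ?_, fun v => ?_⟩
  · simpa [hv] using (hp v hv).1
  · induction hd : T.dist v r using Nat.strong_induction_on generalizing v with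
    | _ d ih =>
      by_cases hv : v = r
      · exact ⟨0, hv⟩
      · obtain ⟨k, hk⟩ := ih _ (hd ▸ (hp v hv).2) (p v) rfl
        exact ⟨k + 1, by rw [Function.iterate_succ_apply, if_neg hv, hk]⟩

theorem IsParentMap.mono {G H : SimpleGraph V} {r : V} {f : V → V} (h : G ≤ H)
    (hf : IsParentMap G r f) : IsParentMap H r f :=
  ⟨hf.1, fun v hv => h (hf.2.1 v hv), hf.2.2⟩

theorem numSpanningTrees_eq_ncard_isParentMap [Finite V] (G : SimpleGraph V) (r : V) :
    numSpanningTrees G = {f | IsParentMap G r f}.ncard := by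
  symm
  refine Set.ncard_congr (fun f _ => parentGraph f)
    (fun f hf => ⟨hf.parentGraph_le, hf.isTree_parentGraph⟩)
    (fun f g hf hg h => hf.eq_of_parentGraph_eq hg h) fun T hT => ?_
  obtain ⟨f, hf⟩ := hT.2.connected.exists_isParentMap r
  refine ⟨f, hf.mono hT.1, ?_⟩
  -- A tree is minimal among connected graphs, so a connected subgraph on all vertices is the whole
  -- tree.
  exact le_antisymm hf.parentGraph_le
    ((SimpleGraph.isTree_iff_minimal_connected.1 hT.2).2 hf.connected_parentGraph
      hf.parentGraph_le)

end ParentMaps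

/-! ### The matrix-tree theorem -/

section MatrixTree

variable {V R : Type*} [Fintype V] [DecidableEq V] [CommRing R]

theorem Matrix.det_one_sub_of_isNilpotent [IsDomain R] {M : Matrix V V R} (hM : IsNilpotent M) :
    (1 - M).det = 1 := by
  have h := (Matrix.isNilpotent_charpoly_sub_pow_of_isNilpotent hM).eq_zero
  have h' := Matrix.eval_charpoly M 1
  rw [sub_eq_zero.1 h] at h'
  simpa using h'.symm

/-- The matrix of `f` as an operator on functions on `V`, restricted to functions vanishing at
`r`. -/
def parentMatrix (R : Type*) [CommRing R] (r : V) (f : V → V) : Matrix V V R :=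
  Matrix.of fun v w => if v ≠ r ∧ f v = w then 1 else 0

theorem parentMatrix_mulVec (r : V) (f : V → V) (x : V → R) (v : V) :
    (parentMatrix R r f *ᵥ x) v = if v = r then 0 else x (f v) := by
  by_cases hv : v = r <;> simp [parentMatrix, Matrix.mulVec, dotProduct, hv]

theorem parentMatrix_pow_mulVec (r : V) (f : V → V) (x : V → R) (k : ℕ) (v : V)
    (h : ∃ j < k, f^[j] v = r) : (parentMatrix R r f ^ k *ᵥ x) v = 0 := by
  induction k generalizing v with
  | zero => simp at h
  | succ k ih =>
    rw [pow_succ', ← Matrix.mulVec_mulVec, parentMatrix_mulVec]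
    split_ifs with hv
    · rfl
    · obtain ⟨j, hj, hjv⟩ := h
      cases j with
      | zero => exact absurd hjv hv
      | succ j => exact ih _ ⟨j, by omega, hjv⟩

theorem det_one_sub_parentMatrix_of_reach [IsDomain R] {r : V} {f : V → V}
    (h : ∀ v, ∃ k, f^[k] v = r) : (1 - parentMatrix R r f).det = 1 := by
  choose k hk using h
  refine Matrix.det_one_sub_of_isNilpotent ⟨∑ v, k v + 1, ?_⟩
  refine Matrix.ext_of_mulVec_single fun w => funext fun v => ?_
  rw [Matrix.zero_mulVec]
  exact parentMatrix_pow_mulVec r f _ _ v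
    ⟨k v, Nat.lt_succ_of_le (Finset.single_le_sum (fun _ _ => Nat.zero_le _) (Finset.mem_univ v)),
      hk v⟩

/-- The indicator of the vertices that never reach `r` is a nonzero kernel vector. -/
theorem det_one_sub_parentMatrix_of_not_reach [IsDomain R] {r : V} {f : V → V}
    (h : ¬ ∀ v, ∃ k, f^[k] v = r) : (1 - parentMatrix R r f).det = 0 := by
  classical
  obtain ⟨v, hv⟩ := not_forall.1 h
  refine Matrix.exists_mulVec_eq_zero_iff.1
    ⟨fun w => if ∃ k, f^[k] w = r then 0 else 1, fun h0 => ?_, funext fun w => ?_⟩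
  · simpa [hv] using congrFun h0 v
  · rw [Matrix.sub_mulVec, Matrix.one_mulVec, Pi.sub_apply, parentMatrix_mulVec, Pi.zero_apply]
    by_cases hw : w = r
    · rw [if_pos ⟨0, hw⟩, if_pos hw, sub_zero]
    · have : (∃ k, f^[k] w = r) ↔ ∃ k, f^[k] (f w) = r := by
        constructor
        · rintro ⟨k, hk⟩
          cases k with
          | zero => exact absurd hk hw
          | succ k => exact ⟨k, hk⟩
        · rintro ⟨k, hk⟩
          exact ⟨k + 1, hk⟩
      simp only [hw, if_false, this, sub_self]

theorem Matrix.det_sum_rows {ι : Type*} [DecidableEq ι] (S : V → Finset ι) (F : V → ι → V → R) :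
    (Matrix.of fun v => ∑ i ∈ S v, F v i).det =
      ∑ f ∈ Fintype.piFinset S, (Matrix.of fun v => F v (f v)).det :=
  (Matrix.detRowAlternating (R := R) (n := V)).toMultilinearMap.map_sum_finset F S

theorem Matrix.det_one_add_vecMulVec (u w : V → R) :
    (1 + Matrix.vecMulVec u w).det = 1 + ∑ i, u i * w i := by
  rw [Matrix.vecMulVec_eq Unit, Matrix.det_one_add_mul_comm]
  simp [Matrix.mul_apply, mul_comm]

/-- The factors 1 + (u - e_r)1ᵀ on the left and 1 + 1(w - e_r)ᵀ on the right fix L and turn e_r e_rᵀ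
into u wᵀ; their determinants are ∑u and ∑w. -/
theorem Matrix.det_add_vecMulVec_of_sums_eq_zero {L : Matrix V V R} (hrow : L *ᵥ 1 = 0)
    (hcol : 1 ᵥ* L = 0) (r : V) (u w : V → R) :
    (L + Matrix.vecMulVec u w).det = (∑ i, u i) * (∑ i, w i) *
      (L + Matrix.vecMulVec (Pi.single r 1) (Pi.single r 1)).det := by
  have hfac : L + Matrix.vecMulVec u w =
      (1 + Matrix.vecMulVec (u - Pi.single r 1) 1) *
        (L + Matrix.vecMulVec (Pi.single r 1) (Pi.single r 1)) *
        (1 + Matrix.vecMulVec 1 (w - Pi.single r 1)) := by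
    have h1 : (1 + Matrix.vecMulVec (u - Pi.single r 1) 1) *
        (L + Matrix.vecMulVec (Pi.single r 1) (Pi.single r 1)) =
        L + Matrix.vecMulVec u (Pi.single r 1) := by
      rw [add_mul, one_mul, mul_add, Matrix.vecMulVec_mul, hcol, Matrix.vecMulVec_mul_vecMulVec]
      ext i j
      simp [Matrix.vecMulVec_apply]
      ring
    rw [h1, mul_add, mul_one, add_mul, Matrix.mul_vecMulVec, hrow, Matrix.vecMulVec_mul_vecMulVec]
    ext i j
    simp [Matrix.vecMulVec_apply]
    ring
  rw [hfac, Matrix.det_mul, Matrix.det_mul, Matrix.det_one_add_vecMulVec,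
    Matrix.det_one_add_vecMulVec]
  simp [Finset.sum_sub_distrib]
  ring

variable (G : SimpleGraph V) [DecidableRel G.Adj]

theorem lapMatrix_row_eq_sum (v : V) :
    G.lapMatrix R v = ∑ w ∈ G.neighborFinset v, (Pi.single v 1 - Pi.single w 1) := by
  funext x
  by_cases h : v = x
  · subst h
    simp [SimpleGraph.lapMatrix, SimpleGraph.degMatrix, Finset.sum_apply, Pi.single_apply]
  · simp [SimpleGraph.lapMatrix, SimpleGraph.degMatrix, Finset.sum_apply, Pi.single_apply, h,
      Ne.symm h, SimpleGraph.adjMatrix_apply]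

/-- Kirchhoff's matrix-tree theorem. -/
theorem det_lapMatrix_add_eq_numSpanningTrees [IsDomain R] (r : V) :
    (G.lapMatrix R + Matrix.vecMulVec (Pi.single r 1) (Pi.single r 1)).det =
      (numSpanningTrees G : R) := by
  classical
  have hcol : 1 ᵥ* G.lapMatrix R = 0 := by
    rw [← Matrix.mulVec_transpose, (G.isSymm_lapMatrix R).eq]
    exact G.lapMatrix_mulVec_const_eq_zero
  let S : V → Finset V := fun v => if v = r then {r} else G.neighborFinset v
  let M : Matrix V V R := Matrix.of fun v => ∑ w ∈ S v, (1 - parentMatrix R r fun _ => w) v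
  -- Adding all other rows to row `r` leaves e_rᵀ there, since the columns of L sum to zero. Every
  -- row is then a sum over choices of a parent, and multilinearity expands the determinant over
  -- maps `f`.
  have hM : (1 + Matrix.vecMulVec (Pi.single r 1) (1 - Pi.single r 1)) *
      (G.lapMatrix R + Matrix.vecMulVec (Pi.single r 1) (Pi.single r 1)) = M := by
    rw [add_mul, one_mul, Matrix.vecMulVec_mul, Matrix.vecMul_add, Matrix.sub_vecMul, hcol,
      Matrix.sub_vecMul, Matrix.vecMul_vecMulVec, Matrix.vecMul_vecMulVec,
      Matrix.single_one_vecMul]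
    funext v
    by_cases hv : v = r
    · subst hv
      funext x
      simp [M, S, Matrix.vecMulVec_apply, parentMatrix, Matrix.one_apply, Pi.single_apply, eq_comm]
    · have : M v = G.lapMatrix R v := by
        rw [lapMatrix_row_eq_sum]
        refine Finset.sum_congr (if_neg hv) fun w _ => funext fun x => ?_
        simp [parentMatrix, Ne.symm hv, Matrix.one_apply, Pi.single_apply, eq_comm]
      rw [this]
      funext x
      simp [Matrix.vecMulVec_apply, hv]
  have hdet : (G.lapMatrix R + Matrix.vecMulVec (Pi.single r 1) (Pi.single r 1)).det = M.det := by
    rw [← hM, Matrix.det_mul, Matrix.det_one_add_vecMulVec]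
    simp [Pi.single_apply]
  have hmat : ∀ f : V → V, (Matrix.of fun v => (1 - parentMatrix R r fun _ => f v) v) =
      1 - parentMatrix R r f := fun f => rfl
  have hterm : ∀ f : V → V, (1 - parentMatrix R r f).det =
      if ∀ v, ∃ k, f^[k] v = r then 1 else 0 := by
    intro f
    split_ifs with h
    · exact det_one_sub_parentMatrix_of_reach h
    · exact det_one_sub_parentMatrix_of_not_reach h
  rw [hdet, Matrix.det_sum_rows]
  simp only [hmat, hterm]
  rw [Finset.sum_boole, numSpanningTrees_eq_ncard_isParentMap G r, ← Set.ncard_coe_finset]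
  congr 2
  ext f
  simp only [Finset.coe_filter, Fintype.mem_piFinset, Set.mem_ofPred_eq, IsParentMap, S,
    ← and_assoc]
  refine and_congr_left fun _ => ⟨fun h => ⟨by simpa using h r, fun v hv => ?_⟩,
    fun h v => ?_⟩
  · simpa [hv] using h v
  · by_cases hv : v = r
    · simp [hv, h.1]
    · simpa [hv] using h.2 v hv

end MatrixTree

/-! ### Determinants for the cycle -/

section Cycle

variable {R : Type*} [CommRing R]

/-- The permutation matrix of the rotation `i ↦ i + 1` of `Fin (m + 1)`. -/
def rotationMatrix (R : Type*) [CommRing R] (m : ℕ) : Matrix (Fin (m + 1)) (Fin (m + 1)) R :=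
  Matrix.of fun i j => if j = i + 1 then 1 else 0

theorem rotationMatrix_mul_transpose (m : ℕ) :
    rotationMatrix R m * (rotationMatrix R m)ᵀ = 1 := by
  ext i j
  simp [rotationMatrix, Matrix.mul_apply, Matrix.one_apply, eq_comm]

theorem rotationMatrix_mulVec_one (m : ℕ) : rotationMatrix R m *ᵥ 1 = 1 := by
  ext i
  simp [rotationMatrix, Matrix.mulVec, dotProduct]

theorem one_vecMul_rotationMatrix (m : ℕ) : 1 ᵥ* rotationMatrix R m = 1 := by
  ext i
  simp [rotationMatrix, Matrix.vecMul, dotProduct, ← sub_eq_iff_eq_add]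

/-- Only the two ends of the first column are nonzero, and their minors are triangular. The term `c`
alters the wrap-around entry, so that `c = 1` removes it. -/
theorem det_smul_one_sub_rotationMatrix_add (m : ℕ) (t c : R) :
    (t • (1 : Matrix (Fin (m + 2)) (Fin (m + 2)) R) - rotationMatrix R (m + 1) +
      Matrix.vecMulVec (Pi.single (Fin.last (m + 1)) c) (Pi.single 0 1)).det =
        t ^ (m + 2) - 1 + c := by
  have hrot : ∀ i j : Fin (m + 2), (j = i + 1) ↔
      (i.val + 1 = j.val ∨ i = Fin.last (m + 1) ∧ j = 0) := by
    intro i j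
    induction i using Fin.lastCases with
    | last => simp; omega
    | cast i =>
      rw [Fin.coeSucc_eq_succ, Fin.ext_iff, Fin.val_succ, Fin.val_castSucc]
      simp only [i.castSucc_ne_last, false_and, or_false, eq_comm]
  generalize hA : t • (1 : Matrix (Fin (m + 2)) (Fin (m + 2)) R) - rotationMatrix R (m + 1) +
      Matrix.vecMulVec (Pi.single (Fin.last (m + 1)) c) (Pi.single 0 1) = A
  have hentry : ∀ i j, A i j = (if i = j then t else 0) - (if i.val + 1 = j.val then 1 else 0) +
      if i = Fin.last (m + 1) ∧ j = 0 then c - 1 else 0 := by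
    intro i j
    rw [← hA]
    simp only [Matrix.add_apply, Matrix.sub_apply, Matrix.smul_apply, Matrix.one_apply,
      rotationMatrix, Matrix.of_apply, hrot, Matrix.vecMulVec_apply, Pi.single_apply]
    by_cases h1 : i = Fin.last (m + 1) <;> by_cases h2 : j = 0 <;> simp [h1, h2]
    ring
  have hupper : (A.submatrix (Fin.succAbove 0) Fin.succ).det = t ^ (m + 1) := by
    rw [Matrix.det_of_isUpperTriangular]
    · simp [hentry]
    · intro i j hij
      have hij : j < i := hij
      have h1 : i ≠ j := hij.ne'
      have h2 : ¬ i.val + 1 = j.val := by omega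
      simp [hentry, h1, h2]
  have hlower : (A.submatrix (Fin.succAbove (Fin.last (m + 1))) Fin.succ).det =
      (-1) ^ (m + 1) := by
    rw [Matrix.det_of_isLowerTriangular]
    · have hne : ∀ i : Fin (m + 1), i.castSucc ≠ i.succ := fun i => i.castSucc_lt_succ.ne
      simp [hentry, hne]
    · intro i j hij
      have hij : i < j := hij
      have h1 : i.castSucc ≠ j.succ := fun h => by
        have := congrArg Fin.val h
        rw [Fin.val_castSucc, Fin.val_succ] at this
        omega
      have h2 : ¬ i.val = j.val := by omega
      simp [hentry, h1, h2]
  have hmid : ∀ i : Fin m, A i.castSucc.succ 0 = 0 := by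
    intro i
    have h : i.val ≠ m := i.isLt.ne
    simp [hentry, Fin.ext_iff, h]
  have hlast : A (Fin.last m).succ 0 = c - 1 := by
    simp [hentry, Fin.ext_iff]
  have hzero : A 0 0 = t := by
    simp [hentry, Fin.ext_iff]
  rw [Matrix.det_succ_column_zero, Fin.sum_univ_succ, Fin.sum_univ_castSucc, Finset.sum_eq_zero]
  · rw [hzero, hupper, hlast, Fin.succ_last, hlower, Fin.val_last, Fin.val_zero, Nat.succ_eq_add_one]
    have hsq : ((-1 : R) ^ (m + 1)) * (-1) ^ (m + 1) = 1 := by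
      rw [← mul_pow]; simp
    linear_combination (c - 1) * hsq
  · intro i _
    rw [hmid, mul_zero, zero_mul]

/-- Adding the second block row to the first, then subtracting the first block column from the
second, makes the matrix block triangular. -/
theorem det_fromBlocks_symm {m : Type*} [Fintype m] [DecidableEq m] (A B : Matrix m m R) :
    (Matrix.fromBlocks A B B A).det = (A + B).det * (A - B).det := by
  have h : Matrix.fromBlocks 1 1 0 1 * Matrix.fromBlocks A B B A * Matrix.fromBlocks 1 (-1) 0 1 =
      Matrix.fromBlocks (A + B) 0 B (A - B) := by
    simp [Matrix.fromBlocks_multiply, ← sub_eq_add_neg, neg_add_eq_sub]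
  have h' := congrArg Matrix.det h
  simpa [Matrix.det_mul, Matrix.det_fromBlocks_zero₂₁, Matrix.det_fromBlocks_zero₁₂] using h'

/-- The Laplacian matrix of the cycle on `m + 1` vertices. -/
def cycleLaplacian (R : Type*) [CommRing R] (m : ℕ) : Matrix (Fin (m + 1)) (Fin (m + 1)) R :=
  (2 : R) • 1 - rotationMatrix R m - (rotationMatrix R m)ᵀ

theorem cycleLaplacian_eq_mul (m : ℕ) : cycleLaplacian R m =
    (1 - rotationMatrix R m) * (1 - rotationMatrix R m)ᵀ := by
  rw [cycleLaplacian, Matrix.transpose_sub, Matrix.transpose_one, sub_mul, mul_sub, mul_sub,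
    rotationMatrix_mul_transpose, two_smul]
  simp only [mul_one, one_mul]
  abel

theorem det_one_sub_rotationMatrix_add_vecMulVec (m : ℕ) (u w : Fin (m + 2) → R) :
    (1 - rotationMatrix R (m + 1) + Matrix.vecMulVec u w).det = (∑ i, u i) * ∑ i, w i := by
  have hrow : (1 - rotationMatrix R (m + 1)) *ᵥ 1 = 0 := by
    rw [Matrix.sub_mulVec, Matrix.one_mulVec, rotationMatrix_mulVec_one, sub_self]
  have hcol : 1 ᵥ* (1 - rotationMatrix R (m + 1)) = 0 := by
    rw [Matrix.vecMul_sub, Matrix.vecMul_one, one_vecMul_rotationMatrix, sub_self]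
  have h := det_smul_one_sub_rotationMatrix_add m (1 : R) 1
  rw [one_smul, Matrix.det_add_vecMulVec_of_sums_eq_zero hrow hcol 0] at h
  rw [Matrix.det_add_vecMulVec_of_sums_eq_zero hrow hcol 0]
  simp at h
  rw [h, mul_one]

theorem cycleLaplacian_mulVec_one (m : ℕ) : cycleLaplacian R m *ᵥ 1 = 0 := by
  rw [cycleLaplacian, Matrix.sub_mulVec, Matrix.sub_mulVec, Matrix.smul_mulVec,
    Matrix.one_mulVec, Matrix.mulVec_transpose, rotationMatrix_mulVec_one,
    one_vecMul_rotationMatrix, two_smul]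
  abel

theorem one_vecMul_cycleLaplacian (m : ℕ) : 1 ᵥ* cycleLaplacian R m = 0 := by
  have h : (cycleLaplacian R m)ᵀ = cycleLaplacian R m := by
    simp [cycleLaplacian, sub_right_comm]
  rw [← Matrix.mulVec_transpose, h, cycleLaplacian_mulVec_one]

theorem det_cycleLaplacian_add_vecMulVec [IsDomain R] [CharZero R] (m : ℕ)
    (u w : Fin (m + 2) → R) :
    (cycleLaplacian R (m + 1) + Matrix.vecMulVec u w).det =
      (∑ i, u i) * (∑ i, w i) * (m + 2 : R) := by
  have hN : (m + 2 : R) ≠ 0 := by exact_mod_cast (m + 1).succ_ne_zero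
  have key := Matrix.det_add_vecMulVec_of_sums_eq_zero (cycleLaplacian_mulVec_one (R := R) (m + 1))
    (one_vecMul_cycleLaplacian (m + 1)) 0
  -- With n = m + 2 this choice of u, w factors, giving determinant (n²)² = n⁴; the sums contribute
  -- n² · n, so cancelling n³ leaves n.
  have hfac : cycleLaplacian R (m + 1) + Matrix.vecMulVec (fun _ => (m + 2 : R)) 1 =
      (1 - rotationMatrix R (m + 1) + Matrix.vecMulVec 1 1) *
        (1 - rotationMatrix R (m + 1) + Matrix.vecMulVec 1 1)ᵀ := by
    have hrow : (1 - rotationMatrix R (m + 1)) *ᵥ 1 = 0 := by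
      rw [Matrix.sub_mulVec, Matrix.one_mulVec, rotationMatrix_mulVec_one, sub_self]
    rw [Matrix.transpose_add, add_mul, mul_add, mul_add, ← cycleLaplacian_eq_mul,
      Matrix.transpose_vecMulVec, Matrix.mul_vecMulVec, hrow, Matrix.vecMulVec_mul,
      Matrix.vecMul_transpose, hrow, Matrix.vecMulVec_mul_vecMulVec]
    ext i j
    simp
    ring
  have h1 := key (fun _ => (m + 2 : R)) 1
  rw [hfac, Matrix.det_mul, Matrix.det_transpose,
    det_one_sub_rotationMatrix_add_vecMulVec] at h1
  simp at h1
  rw [key]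
  congr 1
  refine mul_left_cancel₀ (pow_ne_zero 3 hN) ?_
  linear_combination -h1

/-- For the rotation P, (t - P)(t - P)ᵀ = t² + 1 - t(P + Pᵀ), which the relation on `t` identifies
with t(C + s). -/
theorem pow_mul_det_cycleLaplacian_add (m : ℕ) {t s : R} (h : t ^ 2 + 1 = (2 + s) * t) :
    t ^ (m + 2) * (cycleLaplacian R (m + 1) + s • 1).det = (t ^ (m + 2) - 1) ^ 2 := by
  have hdet := det_smul_one_sub_rotationMatrix_add m t 0
  rw [Pi.single_zero, Matrix.zero_vecMulVec, add_zero, add_zero] at hdet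
  have hfac : t • (cycleLaplacian R (m + 1) + s • 1) =
      (t • 1 - rotationMatrix R (m + 1)) * (t • 1 - rotationMatrix R (m + 1))ᵀ := by
    rw [Matrix.transpose_sub, sub_mul, mul_sub, mul_sub, rotationMatrix_mul_transpose,
      Matrix.transpose_smul, Matrix.transpose_one, cycleLaplacian]
    ext i j
    simp only [Matrix.smul_apply, Matrix.add_apply, Matrix.sub_apply, smul_eq_mul, mul_one,
      one_mul, Matrix.smul_mul, Matrix.mul_smul]
    linear_combination -(1 : Matrix (Fin (m + 2)) (Fin (m + 2)) R) i j * h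
  have := congrArg Matrix.det hfac
  rw [Matrix.det_mul, Matrix.det_transpose, hdet, Matrix.det_smul, Fintype.card_fin] at this
  rw [this, sq]

end Cycle

/-! ### The circular ladder -/

section Ladder

variable {R : Type*} [CommRing R]

theorem lapMatrix_boxProd {α β : Type*} [Fintype α] [Fintype β] [DecidableEq α] [DecidableEq β]
    (G : SimpleGraph α) (H : SimpleGraph β) [DecidableRel G.Adj] [DecidableRel H.Adj]
    [DecidableRel (G.boxProd H).Adj] (x y : α × β) :
    (G.boxProd H).lapMatrix R x y =
      G.lapMatrix R x.1 y.1 * (1 : Matrix β β R) x.2 y.2 +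
        (1 : Matrix α α R) x.1 y.1 * H.lapMatrix R x.2 y.2 := by
  obtain ⟨i, a⟩ := x
  obtain ⟨j, b⟩ := y
  by_cases h1 : i = j <;> by_cases h2 : a = b <;>
    simp [SimpleGraph.lapMatrix, SimpleGraph.degMatrix, SimpleGraph.adjMatrix_apply,
      Matrix.one_apply, SimpleGraph.boxProd_adj, h1, h2]
  rw [SimpleGraph.degree_boxProd, Nat.cast_add]

theorem lapMatrix_cycleGraph (m : ℕ) :
    (SimpleGraph.cycleGraph (m + 3)).lapMatrix R = cycleLaplacian R (m + 2) := by
  ext i j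
  -- At least three vertices are needed for the two cycle neighbours of a vertex to be distinct.
  have h2 : (1 : Fin (m + 3)) + 1 ≠ 0 := by
    simp [Fin.ext_iff, Fin.val_add, Nat.mod_eq_of_lt (show 2 < m + 3 by omega)]
  have hexcl : ¬ (j = i + 1 ∧ i = j + 1) := by
    rintro ⟨rfl, h⟩
    rw [add_assoc, left_eq_add] at h
    exact h2 h
  have e1 : i - j = 1 ↔ i = j + 1 := by rw [sub_eq_iff_eq_add, add_comm 1]
  have e2 : j - i = 1 ↔ j = i + 1 := by rw [sub_eq_iff_eq_add, add_comm 1]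
  simp only [SimpleGraph.lapMatrix, SimpleGraph.degMatrix, cycleLaplacian, rotationMatrix,
    Matrix.sub_apply, Matrix.diagonal_apply, Matrix.smul_apply, Matrix.one_apply,
    Matrix.transpose_apply, Matrix.of_apply, SimpleGraph.adjMatrix_apply,
    SimpleGraph.cycleGraph_adj, SimpleGraph.cycleGraph_degree_three_le, e1, e2]
  split_ifs <;> first | tauto | simp

theorem lapMatrix_top_bool (a b : Bool) :
    (⊤ : SimpleGraph Bool).lapMatrix R a b = if a = b then 1 else -1 := by
  cases a <;> cases b <;> simp [SimpleGraph.lapMatrix, SimpleGraph.degMatrix]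

theorem four_mul_numSpanningTrees_circularLadder (m : ℕ) :
    4 * (numSpanningTrees (circularLadder (m + 3)) : ℝ) =
      2 * (m + 3) * (cycleLaplacian ℝ (m + 2) + (2 : ℝ) • 1).det := by
  classical
  let L := (circularLadder (m + 3)).lapMatrix ℝ
  let e : Fin (m + 3) ⊕ Fin (m + 3) ≃ Fin (m + 3) × Bool :=
    (Equiv.boolProdEquivSum _).symm.trans (Equiv.prodComm _ _)
  -- The indicator of the spoke at 0 is invariant under the swap, so the perturbed Laplacian keeps
  -- equal diagonal and equal off-diagonal blocks.
  let v : Fin (m + 3) × Bool → ℝ := fun x => (Pi.single 0 1 : Fin (m + 3) → ℝ) x.1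
  let C := cycleLaplacian ℝ (m + 2)
  let E : Matrix (Fin (m + 3)) (Fin (m + 3)) ℝ :=
    Matrix.vecMulVec (Pi.single 0 1) (Pi.single 0 1)
  have hrow : L *ᵥ 1 = 0 := SimpleGraph.lapMatrix_mulVec_const_eq_zero _
  have hcol : 1 ᵥ* L = 0 := by
    rw [← Matrix.mulVec_transpose, ((circularLadder (m + 3)).isSymm_lapMatrix ℝ).eq, hrow]
  have hv : ∑ x, v x = 2 := by
    rw [Fintype.sum_prod_type]
    simp [v, ← Finset.mul_sum]
  have hL : ∀ x y, L x y = C x.1 y.1 * (1 : Matrix Bool Bool ℝ) x.2 y.2 +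
      (1 : Matrix (Fin (m + 3)) (Fin (m + 3)) ℝ) x.1 y.1 * if x.2 = y.2 then 1 else -1 := by
    intro x y
    rw [← lapMatrix_top_bool, ← show _ = C from lapMatrix_cycleGraph m]
    exact lapMatrix_boxProd (SimpleGraph.cycleGraph (m + 3)) ⊤ x y
  have hblock : (L + Matrix.vecMulVec v v).submatrix e e =
      Matrix.fromBlocks (C + 1 + E) (E - 1) (E - 1) (C + 1 + E) := by
    ext i j
    rcases i with i | i <;> rcases j with j | j <;>
      simp [hL, e, v, E, Matrix.vecMulVec_apply, Equiv.boolProdEquivSum] <;> ring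
  have hdet := congrArg Matrix.det hblock
  rw [Matrix.det_submatrix_equiv_self, det_fromBlocks_symm,
    Matrix.det_add_vecMulVec_of_sums_eq_zero hrow hcol (0, false), hv,
    det_lapMatrix_add_eq_numSpanningTrees] at hdet
  have hsum : C + 1 + E + (E - 1) = C + Matrix.vecMulVec (Pi.single 0 2) (Pi.single 0 1) := by
    have : Matrix.vecMulVec (Pi.single 0 2) (Pi.single 0 1) = E + E := by
      rw [← Matrix.add_vecMulVec, ← Pi.single_add, one_add_one_eq_two]
    rw [this]
    abel
  have hdiff : C + 1 + E - (E - 1) = C + (2 : ℝ) • 1 := by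
    rw [two_smul]
    abel
  rw [hsum, hdiff, det_cycleLaplacian_add_vecMulVec] at hdet
  simp at hdet
  linear_combination hdet

/-- Both sides satisfy the recurrence of `aSeq` and start with 2, 4. -/
theorem aSeq_succ_add_aSeq {R : Type*} [CommRing R] {α β : R} (hsum : α + β = 4)
    (hprod : α * β = 1) (n : ℕ) : (aSeq (n + 1) + aSeq n : R) = α ^ n + β ^ n := by
  induction n using Nat.twoStepInduction with
  | zero => simp [aSeq]
  | one => simp [aSeq, hsum]; norm_num
  | more n ih1 ih2 =>
    have h1 : aSeq (n + 3) = 4 * aSeq (n + 2) - aSeq (n + 1) := rfl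
    have h2 : aSeq (n + 2) = 4 * aSeq (n + 1) - aSeq n := rfl
    have h : ((aSeq (n + 3) + aSeq (n + 2) : ℤ) : R) =
        ((4 * (aSeq (n + 2) + aSeq (n + 1)) - (aSeq (n + 1) + aSeq n) : ℤ) : R) := by
      congr 1
      linarith
    push_cast at h
    rw [show n + 2 + 1 = n + 3 from rfl, h, ih1]
    rw [show n + 1 + 1 = n + 2 from rfl] at ih2
    rw [ih2]
    linear_combination (-α ^ (n + 1) - β ^ (n + 1)) * hsum + (α ^ n + β ^ n) * hprod

theorem det_cycleLaplacian_add_two (m : ℕ) :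
    (cycleLaplacian ℝ (m + 1) + (2 : ℝ) • 1).det = aSeq (m + 3) + aSeq (m + 2) - 2 := by
  have h3 : √(3 : ℝ) ^ 2 = 3 := Real.sq_sqrt (by norm_num)
  have hprod : (2 + √(3 : ℝ)) * (2 - √3) = 1 := by linear_combination -h3
  have hpos : 0 < 2 + √(3 : ℝ) := by positivity
  have hpow : (2 + √(3 : ℝ)) ^ (m + 2) * (2 - √3) ^ (m + 2) = 1 := by
    rw [← mul_pow, hprod, one_pow]
  -- `2 + √3` is a root of t² + 1 = 4t, with inverse `2 - √3`.
  have hdet := pow_mul_det_cycleLaplacian_add (R := ℝ) m (t := 2 + √3) (s := 2)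
    (by linear_combination h3)
  rw [aSeq_succ_add_aSeq (R := ℝ) (α := 2 + √3) (β := 2 - √3) (by ring) hprod]
  refine mul_left_cancel₀ (pow_pos hpos (m + 2)).ne' ?_
  linear_combination hdet - hpow

end Ladder

theorem mainTheorem5 (n : ℕ) (hn : 3 ≤ n) :
    (numSpanningTrees (circularLadder n) : ℚ) =
      1 / 2 * (n : ℚ) * ((aSeq (n + 1) : ℚ) + (aSeq n : ℚ) - 2) := by
  obtain ⟨m, rfl⟩ := Nat.exists_eq_add_of_le' hn
  have h := four_mul_numSpanningTrees_circularLadder m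
  rw [det_cycleLaplacian_add_two] at h
  have h' : (4 * numSpanningTrees (circularLadder (m + 3)) : ℚ) =
      2 * (m + 3) * (aSeq (m + 4) + aSeq (m + 3) - 2) := by
    exact_mod_cast h
  push_cast
  linear_combination h' / 4
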